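/- Let $\omega=\exp(2\pi i/3)$. For positive integers $k_1,\dots,k_n$ and $a_1,\dots,a_n\in\mathbb{Z}/3\mathbb{Z}$ with $k_1\ge 2$ or $a_1\ne 0$, consider the multiple $L$-value of level $3$ $$L_*(k_1,\dots,k_n;a_1,\dots,a_n)=\sum_{m_1>\cdots>m_n>0}\frac{\omega^{a_1m_1+\cdots+a_nm_n}}{m_1^{k_1}\cdots m_n^{k_n}} =\lim_{M\to\infty}\sum_{M>m_1>\cdots>m_n>0}\frac{\omega^{a_1m_1+\cdots+a_nm_n}}{m_1^{k_1}\cdots m_n^{k_n}}.$$ It is denoted by $\zeta^{(3)}(\cdot,\dots,\cdot)$, where the $i$-th slot is $k_i$ if $a_i=0$, $\overline{k_i}$ if $a_i=1$, and $\widetilde{k_i}$ if $a_i=2$; for instance $L_*(k_1,k_2,k_3;0,1,2)=\zeta^{(3)}(k_1,\overline{k_2},\widetilde{k_3})$. Further let $\zeta(k_1,\dots,k_n)=\sum_{m_1>\cdots>m_n>0}m_1^{-k_1}\cdots m_n^{-k_n}$ $(k_1\ge2)$ be the multiple zeta values. Let $k\ge 3$ be an integer. Then all single and double series occurring below converge (more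 generally, so do those for $\zeta(k)$, for $\zeta(j,k-j)$ with $2\le j\le k-1$, for $L_*(k;a)$ with $a\in\mathbb{Z}/3\mathbb{Z}$, and for $L_*(j,k-j;a,b)$ with $1\le j\le k-1$, $a,b\in\mathbb{Z}/3\mathbb{Z}$, and $j\ge2$ or $a\neq0$), and \begin{align*} \sum_{j=2}^{k-1}2^{j}\zeta(j,k-j)={}&(k+1)\zeta(k),\\ \sum_{j=2}^{k-1}2^{j}\zeta^{(3)}(\overline{j},k-j)={}&2\zeta^{(3)}(\overline{1},\widetilde{k-1})-2\zeta^{(3)}(\overline{1},k-1)+2\zeta^{(3)}(\widetilde{k-1},\overline{1})-2\zeta^{(3)}(\widetilde{k-1},\widetilde{1})\\ &+(k-1)\zeta^{(3)}(\widetilde{k})+2\zeta(k),\\ \sum_{j=2}^{k-1}2^{j}\zeta^{(3)}(\widetilde{j},k-j)={}&2\zeta^{(3)}(\widetilde{1},\overline{k-1})-2\zeta^{(3)}(\widetilde{1},k-1)+2\zeta^{(3)}(\overline{k-1},\widetilde{1})-2\zeta^{(3)}(\overline{k-1},\overline{1})\\ &+(k-1)\zeta^{(3)}(\overline{k})+2\zeta(k),\\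 \sum_{j=2}^{k-1}2^{j-1}\zeta^{(3)}(j,\overline{k-j})+\sum_{j=2}^{k-1}2^{j-1}\zeta^{(3)}(\overline{j},\widetilde{k-j})={}&\zeta^{(3)}(\overline{1},\overline{k-1})-\zeta^{(3)}(\overline{1},\widetilde{k-1})+\zeta^{(3)}(\overline{k-1},\overline{1})-\zeta^{(3)}(\overline{k-1},\widetilde{1})\\ &+k\zeta^{(3)}(\overline{k})+\zeta^{(3)}(\widetilde{k}),\\ \sum_{j=2}^{k-1}2^{j-1}\zeta^{(3)}(j,\widetilde{k-j})+\sum_{j=2}^{k-1}2^{j-1}\zeta^{(3)}(\widetilde{j},\overline{k-j})={}&\zeta^{(3)}(\widetilde{1},\widetilde{k-1})-\zeta^{(3)}(\widetilde{1},\overline{k-1})+\zeta^{(3)}(\widetilde{k-1},\widetilde{1})-\zeta^{(3)}(\widetilde{k-1},\overline{1})\\ &+k\zeta^{(3)}(\widetilde{k})+\zeta^{(3)}(\overline{k}),\\ \sum_{j=2}^{k-1}2^{j-1}\zeta^{(3)}(\overline{j},\overline{k-j})+\sum_{j=2}^{k-1}2^{j-1}\zeta^{(3)}(\widetilde{j},\widetilde{k-j})={}&\zeta^{(3)}(\overline{1},k-1)-\zeta^{(3)}(\overline{1},\overline{k-1})+\zeta^{(3)}(\widetilde{1},k-1)-\zeta^{(3)}(\widetilde{1},\widetilde{k-1})\\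 &+(k-1)\zeta(k)+\zeta^{(3)}(\overline{k})+\zeta^{(3)}(\widetilde{k}). \end{align*} -/

import Mathlib

open Filter Topology

noncomputable section

namespace MultipleL

/-- The primitive `N`-th root of unity `ω_N = exp (2πi / N)`. -/
def omega (N : ℕ) : ℂ := Complex.exp (2 * Real.pi * Complex.I / N)

/-- Truncated nested sum: for the list `[(k₁, a₁), …, (kₙ, aₙ)]` this is
`∑ ω_N ^ (a₁ m₁ + ⋯ + aₙ mₙ) / (m₁ ^ k₁ ⋯ mₙ ^ kₙ)` over all integers
`M > m₁ > ⋯ > mₙ > 0`. -/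
def partialL (N : ℕ) : List (ℕ × ZMod N) → ℕ → ℂ
  | [], _ => 1
  | (k, a) :: l, M =>
      ∑ m ∈ Finset.Ioo 0 M, omega N ^ (a.val * m) / (m : ℂ) ^ k * partialL N l m

/-- The multiple `L`-value `L_*(k₁, …, kₙ; a₁, …, aₙ)` of level `N`, that is, the sum of the
series over `m₁ > ⋯ > mₙ > 0`, taken as the limit of its truncations `m₁ < M` as `M → ∞`
(for `k₁ = 1`, `a₁ ≠ 0` the series converges only conditionally). -/
def valueL (N : ℕ) (l : List (ℕ × ZMod N)) : ℂ := limUnder atTop (partialL N l)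

/-- The series defining the multiple `L`-value converges, and its sum is that value. -/
def ConvergesL (N : ℕ) (l : List (ℕ × ZMod N)) : Prop :=
  Tendsto (partialL N l) atTop (𝓝 (valueL N l))

/-- The indices of level `1` that give a multiple zeta value. -/
def level1 (ks : List ℕ) : List (ℕ × ZMod 1) := ks.map fun k => (k, 0)

/-- The multiple zeta value `ζ(k₁, …, kₙ)`, the multiple `L`-value of level `1`. -/
def zeta (ks : List ℕ) : ℂ := valueL 1 (level1 ks)

/-- The multiple `L`-value `ζ^{(3)}` of level `3`; its slots are written with `plain`
(`a = 0`), `bar` (`a = 1`) and `tilde` (`a = 2`). -/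
def zeta3 (l : List (ℕ × ZMod 3)) : ℂ := valueL 3 l

/-- An undecorated slot `k`. -/
def plain (k : ℕ) : ℕ × ZMod 3 := (k, 0)

/-- An overlined slot. -/
def bar (k : ℕ) : ℕ × ZMod 3 := (k, 1)

/-- A slot with a tilde. -/
def tilde (k : ℕ) : ℕ × ZMod 3 := (k, 2)

end MultipleL

end

open MultipleL

namespace MultipleL

open Finset

/-! ### Finite double sums -/

/-! For characters `a`, `b`, the sum over `r` of the products L(r;a)L(k-r;b) is computed in two
ways. Over squares, the stuffle product gives unweighted sums of double values. Over triangles,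
substituting m = l + n and taking partial fractions gives the weights 2^(j-1)
(`sum_triangleSum_monomial`). The unweighted sums are geometric in each term, so they collapse to
one triangle sum and one double value (`sum_partialL_double`); that triangle sum is again traded for
a square and expanded by stuffle.

Some factors diverge, so everything is done with truncated sums, where square minus triangle tends
to 0 (`tendsto_squareSum_sub_triangleSum_monomial`). The result is `tendsto_weighted_sum`, valid for
all `a`, `b`. Truncated sums with leading slot (1, 0) cancel there before the limit is taken, so no
regularization is needed. The six formulas are the pairs (0,0), (1,1), (2,2), (0,1), (0,2), (1,2).
-/

/-- The sum of `F m n` over `M > m > n > 0`. -/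
noncomputable def lowerSum (F : ℕ → ℕ → ℂ) (M : ℕ) : ℂ := ∑ m ∈ Ioo 0 M, ∑ n ∈ Ioo 0 m, F m n

/-- The sum of `F m n` over `0 < m, n < M`. -/
noncomputable def squareSum (F : ℕ → ℕ → ℂ) (M : ℕ) : ℂ := ∑ m ∈ Ioo 0 M, ∑ n ∈ Ioo 0 M, F m n

/-- The sum of `F l n` over `l, n > 0` with `l + n < M`. -/
noncomputable def triangleSum (F : ℕ → ℕ → ℂ) (M : ℕ) : ℂ := lowerSum (fun m n => F (m - n) n) M

theorem sum_Ioo_zero_succ {M : ℕ} (hM : 0 < M) (f : ℕ → ℂ) :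
    ∑ m ∈ Ioo 0 (M + 1), f m = ∑ m ∈ Ioo 0 M, f m + f M := by
  have h : Ioo 0 (M + 1) = insert M (Ioo 0 M) := by
    ext x; simp only [mem_Ioo, mem_insert]; omega
  rw [h, sum_insert (by simp), add_comm]

theorem squareSum_eq (F : ℕ → ℕ → ℂ) (M : ℕ) :
    squareSum F M = lowerSum F M + lowerSum (fun m n => F n m) M + ∑ m ∈ Ioo 0 M, F m m := by
  unfold squareSum lowerSum
  induction M with
  | zero => simp
  | succ M ih =>
    rcases Nat.eq_zero_or_pos M with rfl | hM
    · have h : Ioo 0 (0 + 1) = ∅ := rfl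
      simp [h]
    · simp only [sum_Ioo_zero_succ hM, sum_add_distrib, ih]
      ring

theorem sum_Ioo_reflect {R : Type*} [AddCommMonoid R] (f : ℕ → R) (m : ℕ) :
    ∑ n ∈ Ioo 0 m, f (m - n) = ∑ n ∈ Ioo 0 m, f n := by
  refine sum_nbij' (fun n => m - n) (fun n => m - n) ?_ ?_ ?_ ?_ fun _ _ => rfl <;>
    · intro n hn
      simp only [mem_Ioo] at *
      omega

theorem lowerSum_congr {F G : ℕ → ℕ → ℂ} (h : ∀ m n, 0 < n → n < m → F m n = G m n) (M : ℕ) :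
    lowerSum F M = lowerSum G M :=
  sum_congr rfl fun m _ => sum_congr rfl fun n hn => h m n (mem_Ioo.1 hn).1 (mem_Ioo.1 hn).2

theorem lowerSum_add (F G : ℕ → ℕ → ℂ) (M : ℕ) :
    lowerSum (fun m n => F m n + G m n) M = lowerSum F M + lowerSum G M := by
  simp only [lowerSum, sum_add_distrib]

theorem lowerSum_sub (F G : ℕ → ℕ → ℂ) (M : ℕ) :
    lowerSum (fun m n => F m n - G m n) M = lowerSum F M - lowerSum G M := by
  simp only [lowerSum, sum_sub_distrib]

theorem lowerSum_const_mul (c : ℂ) (F : ℕ → ℕ → ℂ) (M : ℕ) :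
    lowerSum (fun m n => c * F m n) M = c * lowerSum F M := by
  simp only [lowerSum, mul_sum]

theorem lowerSum_sum (s : Finset ℕ) (F : ℕ → ℕ → ℕ → ℂ) (M : ℕ) :
    lowerSum (fun m n => ∑ i ∈ s, F i m n) M = ∑ i ∈ s, lowerSum (F i) M := by
  simp only [lowerSum]
  rw [sum_comm]
  exact sum_congr rfl fun m _ => sum_comm

theorem lowerSum_reflect (F : ℕ → ℕ → ℂ) (M : ℕ) :
    lowerSum (fun m n => F m (m - n)) M = lowerSum F M :=
  sum_congr rfl fun m _ => sum_Ioo_reflect (F m) m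

theorem triangleSum_swap (F : ℕ → ℕ → ℂ) (M : ℕ) :
    triangleSum (fun l n => F n l) M = triangleSum F M := by
  unfold triangleSum
  rw [← lowerSum_reflect]
  refine lowerSum_congr (fun m n _ h => ?_) M
  rw [Nat.sub_sub_self h.le]

theorem squareSum_swap (F : ℕ → ℕ → ℂ) (M : ℕ) :
    squareSum (fun l n => F n l) M = squareSum F M := by
  unfold squareSum; rw [sum_comm]

theorem triangleSum_eq (F : ℕ → ℕ → ℂ) (M : ℕ) :
    triangleSum F M = ∑ n ∈ Ioo 0 M, ∑ l ∈ Ioo 0 (M - n), F l n := by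
  unfold triangleSum lowerSum
  rw [sum_sigma', sum_sigma']
  refine sum_nbij' (fun p => ⟨p.2, p.1 - p.2⟩) (fun p => ⟨p.1 + p.2, p.1⟩) ?_ ?_ ?_ ?_ ?_
  · rintro ⟨m, n⟩ h; simp only [mem_sigma, mem_Ioo] at *; omega
  · rintro ⟨m, n⟩ h; simp only [mem_sigma, mem_Ioo] at *; omega
  · rintro ⟨m, n⟩ h
    simp only [mem_sigma, mem_Ioo] at *
    rw [Nat.add_sub_cancel' (by omega)]
  · rintro ⟨m, n⟩ h; simp
  · rintro ⟨m, n⟩ h; rfl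

/-- In row n the difference has n terms, each at most 1/((M-n)n²). Their total 1/(n(M-n)) splits as
(1/n + 1/(M-n))/M, which leaves harmonic sums divided by M. -/
theorem norm_squareSum_sub_triangleSum_le {F : ℕ → ℕ → ℂ}
    (hF : ∀ l n, 0 < l → 0 < n → ‖F l n‖ ≤ (l : ℝ)⁻¹ * (n : ℝ)⁻¹ ^ 2) (M : ℕ) :
    ‖squareSum F M - triangleSum F M‖ ≤
      2 * ((M : ℝ)⁻¹ * ∑ n ∈ range M, (n : ℝ)⁻¹) := by
  have hrow : ∀ n ∈ Ioo 0 M, ‖∑ l ∈ Ioo 0 M, F l n - ∑ l ∈ Ioo 0 (M - n), F l n‖ ≤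
      (M : ℝ)⁻¹ * ((n : ℝ)⁻¹ + ((M - n : ℕ) : ℝ)⁻¹) := by
    intro n hn
    rw [mem_Ioo] at hn
    have hsub : Ioo 0 (M - n) ⊆ Ioo 0 M := Ioo_subset_Ioo le_rfl (by omega)
    have hd : Ioo 0 M \ Ioo 0 (M - n) = Ico (M - n) M := by
      ext x; simp only [Finset.mem_sdiff, mem_Ioo, mem_Ico]; omega
    rw [← sum_sdiff hsub, add_sub_cancel_right, hd]
    have hn0 : (0 : ℝ) < n := by exact_mod_cast hn.1
    have hd0 : (0 : ℝ) < (M - n : ℕ) := by exact_mod_cast Nat.sub_pos_of_lt hn.2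
    have hM0 : (M : ℝ) = n + (M - n : ℕ) := by exact_mod_cast (by omega : M = n + (M - n))
    calc ‖∑ l ∈ Ico (M - n) M, F l n‖
        ≤ ∑ l ∈ Ico (M - n) M, ((M - n : ℕ) : ℝ)⁻¹ * (n : ℝ)⁻¹ ^ 2 := by
          refine norm_sum_le_of_le _ fun l hl => ?_
          rw [mem_Ico] at hl
          refine (hF l n (by omega) hn.1).trans ?_
          have : ((M - n : ℕ) : ℝ) ≤ l := by exact_mod_cast hl.1
          gcongr
      _ = (M : ℝ)⁻¹ * ((n : ℝ)⁻¹ + ((M - n : ℕ) : ℝ)⁻¹) := by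
          rw [sum_const, Nat.card_Ico, nsmul_eq_mul, Nat.sub_sub_self hn.2.le, hM0]
          field_simp
          rw [add_comm]
  have hsq : squareSum F M = ∑ n ∈ Ioo 0 M, ∑ l ∈ Ioo 0 M, F l n := sum_comm
  rw [hsq, triangleSum_eq, ← sum_sub_distrib]
  refine (norm_sum_le_of_le _ hrow).trans ?_
  rw [← mul_sum, sum_add_distrib]
  have hrefl : ∑ n ∈ Ioo 0 M, ((M - n : ℕ) : ℝ)⁻¹ = ∑ n ∈ Ioo 0 M, (n : ℝ)⁻¹ :=
    sum_Ioo_reflect (fun n => (n : ℝ)⁻¹) M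
  have hle : ∑ n ∈ Ioo 0 M, (n : ℝ)⁻¹ ≤ ∑ n ∈ range M, (n : ℝ)⁻¹ := by
    refine sum_le_sum_of_subset_of_nonneg (fun x hx => ?_) fun _ _ _ => by positivity
    rw [mem_Ioo] at hx
    exact mem_range.2 hx.2
  rw [hrefl, ← two_mul, mul_left_comm]
  gcongr

theorem tendsto_squareSum_sub_triangleSum {F : ℕ → ℕ → ℂ}
    (hF : ∀ l n, 0 < l → 0 < n → ‖F l n‖ ≤ (l : ℝ)⁻¹ * (n : ℝ)⁻¹ ^ 2) :
    Tendsto (fun M => squareSum F M - triangleSum F M) atTop (𝓝 0) := by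
  refine squeeze_zero_norm (norm_squareSum_sub_triangleSum_le hF) ?_
  -- The bound is twice the Cesàro mean of 1/n, with the term n = 0 equal to 0.
  simpa using (tendsto_inv_atTop_nhds_zero_nat (𝕜 := ℝ)).cesaro.const_mul 2

/-! ### Roots of unity -/

/-- The value `ω_N ^ (a m)`. -/
noncomputable def char {N : ℕ} (a : ZMod N) (m : ℕ) : ℂ := omega N ^ (a.val * m)

theorem omega_pow_self (N : ℕ) [NeZero N] : omega N ^ N = 1 :=
  (Complex.isPrimitiveRoot_exp N (NeZero.ne N)).pow_eq_one

theorem norm_omega (N : ℕ) : ‖omega N‖ = 1 := by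
  have : (2 * Real.pi * Complex.I / N : ℂ) = ((2 * Real.pi / N : ℝ) : ℂ) * Complex.I := by
    push_cast; ring
  rw [omega, this, Complex.norm_exp_ofReal_mul_I]

section char

variable {N : ℕ}

theorem norm_char (a : ZMod N) (m : ℕ) : ‖char a m‖ = 1 := by
  rw [char, norm_pow, norm_omega, one_pow]

theorem char_ne_zero (a : ZMod N) (m : ℕ) : char a m ≠ 0 := by
  rw [← norm_ne_zero_iff, norm_char]; exact one_ne_zero

theorem char_add_right (a : ZMod N) (m n : ℕ) : char a (m + n) = char a m * char a n := by
  simp only [char, mul_add, pow_add]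

theorem char_zero (m : ℕ) : char (0 : ZMod N) m = 1 := by
  simp [char]

theorem char_add_left [NeZero N] (a b : ZMod N) (m : ℕ) :
    char (a + b) m = char a m * char b m := by
  have h (x : ℕ) : omega N ^ x = omega N ^ (x % N) := pow_eq_pow_mod x (omega_pow_self N)
  rw [char, char, char, ← pow_add, ← add_mul, ZMod.val_add, h, h ((a.val + b.val) * m),
    Nat.mod_mul_mod]

theorem char_sub_left [NeZero N] (a b : ZMod N) (m : ℕ) :
    char (a - b) m = char a m * (char b m)⁻¹ := by
  rw [eq_mul_inv_iff_mul_eq₀ (char_ne_zero b m), ← char_add_left, sub_add_cancel]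

theorem char_neg [NeZero N] (b : ZMod N) (m : ℕ) : char (-b) m = (char b m)⁻¹ := by
  rw [← zero_sub, char_sub_left, char_zero, one_mul]

theorem char_sub_right (a : ZMod N) {m n : ℕ} (h : n ≤ m) :
    char a (m - n) = char a m * (char a n)⁻¹ := by
  rw [eq_mul_inv_iff_mul_eq₀ (char_ne_zero a n), ← char_add_right, Nat.sub_add_cancel h]

/-! ### Single and double truncated sums -/

theorem partialL_single (k : ℕ) (a : ZMod N) (M : ℕ) :
    partialL N [(k, a)] M = ∑ m ∈ Ioo 0 M, char a m * (m : ℂ)⁻¹ ^ k := by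
  simp [partialL, char, div_eq_mul_inv]

theorem partialL_double (j i : ℕ) (a b : ZMod N) (M : ℕ) :
    partialL N [(j, a), (i, b)] M =
      lowerSum (fun m n => char a m * char b n * ((m : ℂ)⁻¹ ^ j * (n : ℂ)⁻¹ ^ i)) M := by
  simp only [partialL, lowerSum, mul_sum, char, div_eq_mul_inv, mul_one, inv_pow]
  exact sum_congr rfl fun m _ => sum_congr rfl fun n _ => by ring

/-- The summand of the product of two single series. -/
noncomputable def monomial (a b : ZMod N) (r s : ℕ) (m n : ℕ) : ℂ :=
  char a m * char b n * ((m : ℂ)⁻¹ ^ r * (n : ℂ)⁻¹ ^ s)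

theorem squareSum_monomial_eq_mul (a b : ZMod N) (r s M : ℕ) :
    squareSum (monomial a b r s) M = partialL N [(r, a)] M * partialL N [(s, b)] M := by
  rw [partialL_single, partialL_single, sum_mul_sum]
  exact sum_congr rfl fun m _ => sum_congr rfl fun n _ => by rw [monomial]; ring

theorem squareSum_monomial [NeZero N] (a b : ZMod N) (r s M : ℕ) :
    squareSum (monomial a b r s) M =
      partialL N [(r, a), (s, b)] M + partialL N [(s, b), (r, a)] M
        + partialL N [(r + s, a + b)] M := by
  rw [squareSum_eq, partialL_double, partialL_double, partialL_single]
  congr 1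
  · congr 1
    exact lowerSum_congr (fun m n _ _ => by rw [monomial]; ring) M
  · exact sum_congr rfl fun m _ => by rw [monomial, char_add_left, pow_add]

theorem partialL_mul_partialL [NeZero N] (a b : ZMod N) (r s M : ℕ) :
    partialL N [(r, a)] M * partialL N [(s, b)] M =
      partialL N [(r, a), (s, b)] M + partialL N [(s, b), (r, a)] M
        + partialL N [(r + s, a + b)] M := by
  rw [← squareSum_monomial_eq_mul, squareSum_monomial]

theorem norm_inv_pow_le {m r s : ℕ} (hm : 0 < m) (h : s ≤ r) :
    ‖(m : ℂ)⁻¹ ^ r‖ ≤ (m : ℝ)⁻¹ ^ s := by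
  rw [norm_pow, norm_inv, Complex.norm_natCast]
  exact pow_le_pow_of_le_one (by positivity) (inv_le_one_of_one_le₀ (by exact_mod_cast hm)) h

theorem tendsto_squareSum_sub_triangleSum_monomial (a b : ZMod N) {r s : ℕ} (hr : 1 ≤ r)
    (hs : 1 ≤ s) (h : 3 ≤ r + s) :
    Tendsto (fun M => squareSum (monomial a b r s) M - triangleSum (monomial a b r s) M)
      atTop (𝓝 0) := by
  have key : ∀ (a b : ZMod N) {r s : ℕ}, 1 ≤ r → 2 ≤ s →
      Tendsto (fun M => squareSum (monomial a b r s) M - triangleSum (monomial a b r s) M)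
        atTop (𝓝 0) := by
    intro a b r s hr hs
    refine tendsto_squareSum_sub_triangleSum fun l n hl hn => ?_
    rw [monomial, norm_mul, norm_mul, norm_char, norm_char, one_mul, one_mul, norm_mul]
    have := norm_inv_pow_le hl hr
    rw [pow_one] at this
    exact mul_le_mul this (norm_inv_pow_le hn hs) (norm_nonneg _) (by positivity)
  rcases Nat.lt_or_ge 1 s with hs' | hs'
  · exact key a b hr hs'
  -- Here s = 1, so r ≥ 2 and the roles of the two variables are exchanged.
  · have := key b a hs (by omega : 2 ≤ r)
    have e : (fun l n => monomial b a s r n l) = monomial a b r s := by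
      ext l n; simp only [monomial]; ring
    simpa only [← squareSum_swap (monomial b a s r), ← triangleSum_swap (monomial b a s r), e]
      using this

/-! ### Partial fractions -/

theorem sum_pow_mul_pow_succ_top (x y : ℂ) {k : ℕ} (hk : 1 ≤ k) :
    ∑ r ∈ Ico 1 (k + 1), x ^ r * y ^ (k + 1 - r) =
      y * ∑ r ∈ Ico 1 k, x ^ r * y ^ (k - r) + x ^ k * y := by
  rw [sum_Ico_succ_top hk, mul_sum, Nat.add_sub_cancel_left, pow_one]
  congr 1
  refine sum_congr rfl fun r hr => ?_
  rw [Nat.succ_sub (mem_Ico.1 hr).2.le, pow_succ]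
  ring

theorem sum_pow_mul_pow_succ_bot (x y : ℂ) {k : ℕ} (hk : 1 ≤ k) :
    ∑ r ∈ Ico 1 (k + 1), x ^ r * y ^ (k + 1 - r) =
      x * ∑ r ∈ Ico 1 k, x ^ r * y ^ (k - r) + x * y ^ k := by
  rw [sum_eq_sum_Ico_succ_bot (by omega), ← sum_Ico_add' _ 1 k 1, mul_sum, add_comm, pow_one,
    Nat.add_sub_cancel]
  congr 1
  refine sum_congr rfl fun r _ => ?_
  rw [Nat.add_sub_add_right, pow_succ]
  ring

theorem sum_pow_mul_pow_mul_sub (x y : ℂ) {k : ℕ} (hk : 1 ≤ k) :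
    (∑ r ∈ Ico 1 k, x ^ r * y ^ (k - r)) * (y - x) = x * y ^ k - x ^ k * y := by
  linear_combination sum_pow_mul_pow_succ_bot x y hk - sum_pow_mul_pow_succ_top x y hk

/-- Writing S_k for the left side, S_{k+1} = y S_k + x^k y = x S_k + x y^k. Adding x times the first
to y times the second gives S_{k+1} = z(x^k + y^k) + 2z S_k; the 2 here produces the weights. -/
theorem sum_pow_mul_pow_eq {x y z : ℂ} (hxy : x + y ≠ 0) (h : z * (x + y) = x * y) (k : ℕ) :
    ∑ r ∈ Ico 1 k, x ^ r * y ^ (k - r) =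
      ∑ j ∈ Ico 1 k, 2 ^ (j - 1) * (z ^ j * (x ^ (k - j) + y ^ (k - j))) := by
  induction k with
  | zero => simp
  | succ k ih =>
    rcases Nat.eq_zero_or_pos k with rfl | hk
    · simp
    have hstep :
        ∑ j ∈ Ico 1 (k + 1), 2 ^ (j - 1) * (z ^ j * (x ^ (k + 1 - j) + y ^ (k + 1 - j))) =
        z * (x ^ k + y ^ k) +
          2 * z * ∑ j ∈ Ico 1 k, 2 ^ (j - 1) * (z ^ j * (x ^ (k - j) + y ^ (k - j))) := by
      rw [sum_eq_sum_Ico_succ_bot (by omega), ← sum_Ico_add' _ 1 k 1, mul_sum, Nat.add_sub_cancel]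
      congr 1
      · simp
      · refine sum_congr rfl fun j hj => ?_
        obtain ⟨i, rfl⟩ := Nat.exists_eq_add_of_le' (mem_Ico.1 hj).1
        simp only [Nat.add_sub_add_right, Nat.add_sub_cancel, pow_succ]
        ring
    apply mul_left_cancel₀ hxy
    rw [hstep, ← ih]
    linear_combination (-(x ^ k + y ^ k) - 2 * ∑ r ∈ Ico 1 k, x ^ r * y ^ (k - r)) * h +
      x * sum_pow_mul_pow_succ_top x y hk + y * sum_pow_mul_pow_succ_bot x y hk

end char


section relations

variable {N : ℕ}

/-! ### Double shuffle relations between truncated sums -/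

/-- Partial fractions with x = 1/l, y = 1/n, z = 1/m, where m = l + n. The character a(l)b(n) equals
both a(m)(b-a)(n) and b(m)(a-b)(l); the second double sum is reflected by n ↦ m - n so that the
identity holds term by term. -/
theorem sum_triangleSum_monomial [NeZero N] (a b : ZMod N) (k M : ℕ) :
    ∑ r ∈ Ico 1 k, triangleSum (monomial a b r (k - r)) M =
      ∑ j ∈ Ico 1 k, 2 ^ (j - 1) * (partialL N [(j, a), (k - j, b - a)] M +
        partialL N [(j, b), (k - j, a - b)] M) := by
  have hr (j : ℕ) : partialL N [(j, b), (k - j, a - b)] M = lowerSum (fun m n => char b m *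
      char (a - b) (m - n) * ((m : ℂ)⁻¹ ^ j * ((m - n : ℕ) : ℂ)⁻¹ ^ (k - j))) M := by
    rw [partialL_double, ← lowerSum_reflect]
  simp only [hr, partialL_double, triangleSum, ← lowerSum_add, ← lowerSum_const_mul,
    ← lowerSum_sum]
  refine lowerSum_congr (fun m n hn hnm => ?_) M
  have hn0 : (n : ℂ) ≠ 0 := by exact_mod_cast hn.ne'
  have hd0 : ((m - n : ℕ) : ℂ) ≠ 0 := by exact_mod_cast (Nat.sub_pos_of_lt hnm).ne'
  have hm0 : (m : ℂ) ≠ 0 := by exact_mod_cast (hn.trans hnm).ne'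
  have hm : (m : ℂ) = (m - n : ℕ) + n := by exact_mod_cast (Nat.sub_add_cancel hnm.le).symm
  have hadd : ((m - n : ℕ) : ℂ)⁻¹ + (n : ℂ)⁻¹ = (m : ℂ) * (((m - n : ℕ) : ℂ)⁻¹ * (n : ℂ)⁻¹) := by
    rw [hm]; field_simp; ring
  have key := sum_pow_mul_pow_eq (x := ((m - n : ℕ) : ℂ)⁻¹) (y := (n : ℂ)⁻¹) (z := (m : ℂ)⁻¹)
    (by rw [hadd]; simp [hn0, hd0, hm0]) (by rw [hadd, inv_mul_cancel_left₀ hm0]) k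
  simp only [monomial]
  rw [← mul_sum, key, mul_sum]
  refine sum_congr rfl fun j _ => ?_
  have h1 : char a m * char (b - a) n = char a (m - n) * char b n := by
    rw [char_sub_left, char_sub_right a hnm.le]; ring
  have h2 : char b m * char (a - b) (m - n) = char a (m - n) * char b n := by
    have := char_ne_zero b m
    have := char_ne_zero b n
    rw [char_sub_left, char_sub_right b hnm.le]; field_simp
  rw [h1, h2]
  ring

/-- The geometric sum over r is (n^(1-k) - m^(1-k))/(m-n). The first part lives on the triangle with
l = m - n, and the second is a double sum after reflection. -/
theorem sum_partialL_double [NeZero N] (a b : ZMod N) {k : ℕ} (hk : 1 ≤ k) (M : ℕ) :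
    ∑ r ∈ Ico 1 k, partialL N [(r, a), (k - r, b)] M =
      triangleSum (monomial a (a + b) 1 (k - 1)) M -
        partialL N [(k - 1, a + b), (1, -b)] M := by
  have hr : partialL N [(k - 1, a + b), (1, -b)] M = lowerSum (fun m n => char (a + b) m *
      char (-b) (m - n) * ((m : ℂ)⁻¹ ^ (k - 1) * ((m - n : ℕ) : ℂ)⁻¹ ^ 1)) M := by
    rw [partialL_double, ← lowerSum_reflect]
  simp only [hr, partialL_double, triangleSum, ← lowerSum_sub, ← lowerSum_sum]
  refine lowerSum_congr (fun m n hn hnm => ?_) M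
  have hn0 : (n : ℂ) ≠ 0 := by exact_mod_cast hn.ne'
  have hd0 : ((m - n : ℕ) : ℂ) ≠ 0 := by exact_mod_cast (Nat.sub_pos_of_lt hnm).ne'
  have hm0 : (m : ℂ) ≠ 0 := by exact_mod_cast (hn.trans hnm).ne'
  have hm : (m : ℂ) = (m - n : ℕ) + n := by exact_mod_cast (Nat.sub_add_cancel hnm.le).symm
  have key : ∑ r ∈ Ico 1 k, (m : ℂ)⁻¹ ^ r * (n : ℂ)⁻¹ ^ (k - r) =
      ((m - n : ℕ) : ℂ)⁻¹ * ((n : ℂ)⁻¹ ^ (k - 1) - (m : ℂ)⁻¹ ^ (k - 1)) := by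
    have h := sum_pow_mul_pow_mul_sub (m : ℂ)⁻¹ (n : ℂ)⁻¹ hk
    have hsub : (n : ℂ)⁻¹ - (m : ℂ)⁻¹ = ((m - n : ℕ) : ℂ) * ((m : ℂ)⁻¹ * (n : ℂ)⁻¹) := by
      field_simp
      rw [hm]; ring
    obtain ⟨i, rfl⟩ := Nat.exists_eq_add_of_le' hk
    have hp : (m - n : ℕ) * ((m : ℂ)⁻¹ * (n : ℂ)⁻¹) ≠ 0 := by simp [hn0, hd0, hm0]
    apply mul_right_cancel₀ hp
    rw [← hsub, h, hsub, Nat.add_sub_cancel, pow_succ, pow_succ]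
    linear_combination (-(m : ℂ)⁻¹ * (n : ℂ)⁻¹ * ((n : ℂ)⁻¹ ^ i - (m : ℂ)⁻¹ ^ i)) *
      inv_mul_cancel₀ hd0
  rw [← mul_sum, key, monomial]
  have h1 : char a (m - n) * char (a + b) n = char a m * char b n := by
    have := char_ne_zero a n
    rw [char_add_left, char_sub_right a hnm.le]; field_simp
  have h2 : char (a + b) m * char (-b) (m - n) = char a m * char b n := by
    have := char_ne_zero b m
    have := char_ne_zero b n
    rw [char_add_left, char_neg, char_sub_right b hnm.le]; field_simp
  rw [h1, h2]
  ring

theorem tendsto_weighted_sum [NeZero N] (a b : ZMod N) {k : ℕ} (hk : 3 ≤ k) :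
    Tendsto (fun M => ∑ j ∈ Ico 2 k, 2 ^ (j - 1) * (partialL N [(j, a), (k - j, b - a)] M +
          partialL N [(j, b), (k - j, a - b)] M)
        + (partialL N [(1, a), (k - 1, b - a)] M + partialL N [(1, b), (k - 1, a - b)] M
        - (partialL N [(1, a), (k - 1, a + b)] M + partialL N [(k - 1, a + b), (1, a)] M
          + partialL N [(k, a + (a + b))] M - partialL N [(k - 1, a + b), (1, -b)] M)
        - (partialL N [(1, b), (k - 1, b + a)] M + partialL N [(k - 1, b + a), (1, b)] M
          + partialL N [(k, b + (b + a))] M - partialL N [(k - 1, b + a), (1, -a)] M)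
        - ((k : ℂ) - 1) * partialL N [(k, a + b)] M)) atTop (𝓝 0) := by
  have hD := tendsto_finsetSum (Ico 1 k) fun r hr =>
    tendsto_squareSum_sub_triangleSum_monomial a b (r := r) (s := k - r)
      (mem_Ico.1 hr).1 (by have := (mem_Ico.1 hr).2; omega) (by have := (mem_Ico.1 hr).2; omega)
  have hE (a b : ZMod N) := tendsto_squareSum_sub_triangleSum_monomial a (a + b) (r := 1)
      (s := k - 1) le_rfl (by omega) (by omega)
  have h := ((hD.add (hE a b)).add (hE b a)).neg
  simp only [sum_const_zero, add_zero, neg_zero] at h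
  refine h.congr fun M => ?_
  have h1 := sum_triangleSum_monomial a b k M
  -- The term j = 1 is split off because it may diverge and must cancel against the stuffle terms.
  rw [sum_eq_sum_Ico_succ_bot (a := 1) (by omega : 1 < k) (fun j => 2 ^ (j - 1) *
    (partialL N [(j, a), (k - j, b - a)] M + partialL N [(j, b), (k - j, a - b)] M))] at h1
  have h2 := sum_partialL_double a b (by omega : 1 ≤ k) M
  have h3 := sum_partialL_double b a (by omega : 1 ≤ k) M
  have h4 : ∑ r ∈ Ico 1 k, squareSum (monomial a b r (k - r)) M =
      ∑ r ∈ Ico 1 k, partialL N [(r, a), (k - r, b)] M +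
        ∑ r ∈ Ico 1 k, partialL N [(r, b), (k - r, a)] M +
        ((k : ℂ) - 1) * partialL N [(k, a + b)] M := by
    have hrefl : ∑ r ∈ Ico 1 k, partialL N [(k - r, b), (r, a)] M =
        ∑ r ∈ Ico 1 k, partialL N [(r, b), (k - r, a)] M := by
      refine sum_nbij' (fun r => k - r) (fun r => k - r) ?_ ?_ ?_ ?_ ?_
      all_goals
        intro r hr
        simp only [mem_Ico] at *
      on_goal 5 => rw [Nat.sub_sub_self hr.2.le]
      all_goals omega
    have hc : ∑ r ∈ Ico 1 k, partialL N [(r + (k - r), a + b)] M =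
        ((k : ℂ) - 1) * partialL N [(k, a + b)] M := by
      rw [sum_congr rfl fun r hr => by rw [Nat.add_sub_cancel' (mem_Ico.1 hr).2.le], sum_const,
        Nat.card_Ico, nsmul_eq_mul, Nat.cast_sub (by omega), Nat.cast_one]
    simp only [squareSum_monomial, sum_add_distrib]
    rw [hrefl, hc]
  have h5 (a b : ZMod N) := squareSum_monomial a (a + b) 1 (k - 1) M
  have h5a := h5 a b
  have h5b := h5 b a
  rw [Nat.add_sub_cancel' (by omega : 1 ≤ k)] at h5a h5b
  rw [sum_sub_distrib, h4, h1, h2, h3, h5a, h5b, Nat.sub_self, pow_zero]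
  ring

/-! ### Convergence -/

theorem ConvergesL.of_tendsto {l : List (ℕ × ZMod N)} {x : ℂ}
    (h : Tendsto (partialL N l) atTop (𝓝 x)) : ConvergesL N l := by
  rw [ConvergesL, valueL, h.limUnder_eq]; exact h

theorem sum_Ioo_zero_eq_sum_range (f : ℕ → ℂ) (M : ℕ) :
    ∑ m ∈ Ioo 0 (M + 1), f m = ∑ m ∈ range M, f (m + 1) := by
  induction M with
  | zero => rfl
  | succ M ih => rw [sum_Ioo_zero_succ M.succ_pos, ih, sum_range_succ]

theorem tendsto_sum_Ioo_of_summable {f : ℕ → ℂ} (hf : Summable f) :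
    ∃ x, Tendsto (fun M => ∑ m ∈ Ioo 0 M, f m) atTop (𝓝 x) := by
  refine ⟨∑' m, f (m + 1), (tendsto_add_atTop_iff_nat 1).1 ?_⟩
  simp only [sum_Ioo_zero_eq_sum_range]
  exact ((summable_nat_add_iff 1).2 hf).hasSum.tendsto_sum_nat

theorem convergesL_single (a : ZMod N) {k : ℕ} (hk : 2 ≤ k) : ConvergesL N [(k, a)] := by
  have hs : Summable fun m : ℕ => char a m * (m : ℂ)⁻¹ ^ k := by
    refine Summable.of_norm_bounded (Real.summable_nat_pow_inv.2 (by omega : 1 < k)) fun m => ?_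
    rw [norm_mul, norm_char, one_mul, norm_pow, norm_inv, Complex.norm_natCast, inv_pow]
  obtain ⟨x, hx⟩ := tendsto_sum_Ioo_of_summable hs
  exact .of_tendsto (hx.congr fun M => (partialL_single k a M).symm)

theorem norm_sum_char_le [NeZero N] {a : ZMod N} (ha : a ≠ 0) (n : ℕ) :
    ‖∑ i ∈ range n, char a (i + 1)‖ ≤ 2 / ‖omega N ^ a.val - 1‖ := by
  have hne : omega N ^ a.val ≠ 1 :=
    (Complex.isPrimitiveRoot_exp N (NeZero.ne N)).pow_ne_one_of_pos_of_lt
      ((ZMod.val_ne_zero a).2 ha) (ZMod.val_lt a)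
  simp only [char, pow_mul, pow_succ]
  rw [← sum_mul, geom_sum_eq hne, norm_mul, norm_div, norm_pow, norm_omega, one_pow, mul_one]
  gcongr
  refine (norm_sub_le _ _).trans ?_
  rw [← pow_mul, norm_pow, norm_omega, one_pow, norm_one]
  norm_num

/-- Dirichlet's test: a nontrivial character has bounded partial sums. -/
theorem convergesL_single_one [NeZero N] {a : ZMod N} (ha : a ≠ 0) : ConvergesL N [(1, a)] := by
  have hanti : Antitone fun n : ℕ => ((n : ℝ) + 1)⁻¹ := fun m n h => by
    have : (m : ℝ) ≤ n := by exact_mod_cast h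
    dsimp only
    gcongr
  have h0 : Tendsto (fun n : ℕ => ((n : ℝ) + 1)⁻¹) atTop (𝓝 0) := by
    simpa only [one_div] using tendsto_one_div_add_atTop_nhds_zero_nat (𝕜 := ℝ)
  obtain ⟨x, hx⟩ := cauchySeq_tendsto_of_complete
    (hanti.cauchySeq_series_mul_of_tendsto_zero_of_bounded h0 (norm_sum_char_le ha))
  refine .of_tendsto (x := x) ((tendsto_add_atTop_iff_nat 1).1 (hx.congr fun M => ?_))
  rw [partialL_single, sum_Ioo_zero_eq_sum_range]
  refine sum_congr rfl fun m _ => ?_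
  rw [Complex.real_smul]
  push_cast
  ring

/-- Since n < m, 1/(m²n) ≤ m^(-3/2) n^(-3/2), and the right side is summable over both variables
separately. -/
theorem convergesL_double (a b : ZMod N) {j i : ℕ} (hj : 2 ≤ j) (hi : 1 ≤ i) :
    ConvergesL N [(j, a), (i, b)] := by
  have hsum : Summable fun n : ℕ => ((n : ℝ) ^ (3 / 2 : ℝ))⁻¹ :=
    Real.summable_nat_rpow_inv.2 (by norm_num)
  have hs : Summable fun m : ℕ => ∑ n ∈ Ioo 0 m,
      char a m * char b n * ((m : ℂ)⁻¹ ^ j * (n : ℂ)⁻¹ ^ i) := by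
    refine Summable.of_norm_bounded (hsum.mul_right (∑' n : ℕ, ((n : ℝ) ^ (3 / 2 : ℝ))⁻¹))
      fun m => ?_
    refine (norm_sum_le_of_le (f := fun n => char a m * char b n * ((m : ℂ)⁻¹ ^ j * (n : ℂ)⁻¹ ^ i))
      (n := fun n => ((m : ℝ) ^ (3 / 2 : ℝ))⁻¹ * ((n : ℝ) ^ (3 / 2 : ℝ))⁻¹) (Ioo 0 m)
      fun n hn => ?_).trans ?_
    · rw [mem_Ioo] at hn
      have hn0 : (0 : ℝ) < n := by exact_mod_cast hn.1
      have hm0 : (0 : ℝ) < m := by exact_mod_cast hn.1.trans hn.2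
      have hnm : (n : ℝ) ≤ m := by exact_mod_cast hn.2.le
      rw [norm_mul, norm_mul, norm_char, norm_char, one_mul, one_mul, norm_mul]
      refine (mul_le_mul (norm_inv_pow_le (hn.1.trans hn.2) hj) (norm_inv_pow_le hn.1 hi)
        (norm_nonneg _) (by positivity)).trans ?_
      rw [inv_pow, inv_pow, ← mul_inv, ← mul_inv, pow_one]
      refine inv_anti₀ (by positivity) ?_
      have hm2 : (m : ℝ) ^ 2 = (m : ℝ) ^ (3 / 2 : ℝ) * (m : ℝ) ^ (1 / 2 : ℝ) := by
        rw [← Real.rpow_add hm0, ← Real.rpow_natCast]; norm_num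
      have hn2 : (n : ℝ) ^ (3 / 2 : ℝ) = (n : ℝ) ^ (1 / 2 : ℝ) * n := by
        rw [← Real.rpow_add_one hn0.ne']; norm_num
      rw [hm2, hn2, mul_assoc]
      gcongr
    · rw [← mul_sum]
      gcongr
      exact hsum.sum_le_tsum _ fun _ _ => by positivity
  obtain ⟨x, hx⟩ := tendsto_sum_Ioo_of_summable hs
  exact .of_tendsto (hx.congr fun M => (partialL_double j i a b M).symm)

/-- The stuffle product expresses this conditionally convergent series through convergent ones. -/
theorem convergesL_double_one [NeZero N] {a : ZMod N} (ha : a ≠ 0) (b : ZMod N) {i : ℕ} (hi : 2 ≤ i) :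
    ConvergesL N [(1, a), (i, b)] := by
  have h := (((convergesL_single_one ha).mul (convergesL_single b hi)).sub
    (convergesL_double b a hi le_rfl)).sub (convergesL_single (a + b) (by omega : 2 ≤ 1 + i))
  refine .of_tendsto (h.congr fun M => ?_)
  rw [partialL_mul_partialL]
  ring

theorem tendsto_sum_double (a b c d : ZMod N) (k : ℕ) :
    Tendsto (fun M => ∑ j ∈ Ico 2 k, 2 ^ (j - 1) * (partialL N [(j, a), (k - j, c)] M +
        partialL N [(j, b), (k - j, d)] M)) atTop
      (𝓝 (∑ j ∈ Ico 2 k, 2 ^ (j - 1) * (valueL N [(j, a), (k - j, c)] +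
        valueL N [(j, b), (k - j, d)]))) := by
  refine tendsto_finsetSum _ fun j hj => ?_
  have := mem_Ico.1 hj
  exact ((convergesL_double a c this.1 (by omega)).add
    (convergesL_double b d this.1 (by omega))).const_mul _

/-! ### Weighted sum formulas -/

theorem weighted_sum_zero_zero [NeZero N] {k : ℕ} (hk : 3 ≤ k) :
    ∑ j ∈ Ico 2 k, 2 ^ (j - 1) * (valueL N [(j, 0), (k - j, 0)] + valueL N [(j, 0), (k - j, 0)])
      = ((k : ℂ) + 1) * valueL N [(k, 0)] := by
  have h := tendsto_weighted_sum (0 : ZMod N) 0 hk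
  have h' := (tendsto_sum_double (0 : ZMod N) 0 0 0 k).sub
    ((convergesL_single (0 : ZMod N) (by omega : 2 ≤ k)).const_mul ((k : ℂ) + 1))
  refine sub_eq_zero.1 (tendsto_nhds_unique h' (h.congr fun M => ?_))
  simp only [sub_zero, add_zero, neg_zero]
  ring

/-- The possibly divergent slot (1, 0) leads only the sums with second slot (k-1, b), which occur
with opposite signs. -/
theorem weighted_sum_zero [NeZero N] {b : ZMod N} (hb : b ≠ 0) {k : ℕ} (hk : 3 ≤ k) :
    ∑ j ∈ Ico 2 k, 2 ^ (j - 1) * (valueL N [(j, 0), (k - j, b)] + valueL N [(j, b), (k - j, -b)])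
      = valueL N [(1, b), (k - 1, b)] - valueL N [(1, b), (k - 1, -b)]
        + valueL N [(k - 1, b), (1, b)] - valueL N [(k - 1, b), (1, -b)]
        + k * valueL N [(k, b)] + valueL N [(k, b + b)] := by
  have h := tendsto_weighted_sum 0 b hk
  have h1 (c : ZMod N) := convergesL_double_one hb c (by omega : 2 ≤ k - 1)
  have h2 (c : ZMod N) := convergesL_double b c (by omega : 2 ≤ k - 1) le_rfl
  have h3 (c : ZMod N) := convergesL_single c (by omega : 2 ≤ k)
  have h' := (tendsto_sum_double 0 b b (-b) k).sub
    ((((((h1 b).sub (h1 (-b))).add (h2 b)).sub (h2 (-b))).add ((h3 b).const_mul (k : ℂ))).add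
      (h3 (b + b)))
  refine sub_eq_zero.1 (tendsto_nhds_unique h' (h.congr fun M => ?_))
  simp only [sub_zero, zero_sub, zero_add, add_zero, neg_zero]
  ring

theorem weighted_sum [NeZero N] {a b : ZMod N} (ha : a ≠ 0) (hb : b ≠ 0) {k : ℕ} (hk : 3 ≤ k) :
    ∑ j ∈ Ico 2 k, 2 ^ (j - 1) *
        (valueL N [(j, a), (k - j, b - a)] + valueL N [(j, b), (k - j, a - b)])
      = valueL N [(1, a), (k - 1, a + b)] - valueL N [(1, a), (k - 1, b - a)]
        + (valueL N [(1, b), (k - 1, b + a)] - valueL N [(1, b), (k - 1, a - b)])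
        + (valueL N [(k - 1, a + b), (1, a)] - valueL N [(k - 1, a + b), (1, -b)])
        + (valueL N [(k - 1, b + a), (1, b)] - valueL N [(k - 1, b + a), (1, -a)])
        + ((k : ℂ) - 1) * valueL N [(k, a + b)]
        + valueL N [(k, a + (a + b))] + valueL N [(k, b + (b + a))] := by
  have h := tendsto_weighted_sum a b hk
  have h1 (c : ZMod N) := convergesL_double_one ha c (by omega : 2 ≤ k - 1)
  have h1' (c : ZMod N) := convergesL_double_one hb c (by omega : 2 ≤ k - 1)
  have h2 (c d : ZMod N) := convergesL_double c d (by omega : 2 ≤ k - 1) le_rfl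
  have h3 (c : ZMod N) := convergesL_single c (by omega : 2 ≤ k)
  have h' := (tendsto_sum_double a b (b - a) (a - b) k).sub
    ((((((((h1 (a + b)).sub (h1 (b - a))).add ((h1' (b + a)).sub (h1' (a - b)))).add
      ((h2 (a + b) a).sub (h2 (a + b) (-b)))).add ((h2 (b + a) b).sub (h2 (b + a) (-a)))).add
      ((h3 (a + b)).const_mul ((k : ℂ) - 1))).add (h3 (a + (a + b)))).add (h3 (b + (b + a))))
  refine sub_eq_zero.1 (tendsto_nhds_unique h' (h.congr fun M => ?_))
  ring

theorem zeta_single_eq (k : ℕ) : MultipleL.zeta [k] = valueL N [(k, 0)] := by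
  rw [MultipleL.zeta, valueL, valueL]
  congr 1
  ext M
  rw [level1, List.map_singleton, partialL_single, partialL_single]
  simp only [char_zero]

theorem two_pow_mul_eq {j : ℕ} (hj : 1 ≤ j) (x : ℂ) :
    (2 : ℂ) ^ j * x = 2 ^ (j - 1) * (x + x) := by
  obtain ⟨i, rfl⟩ := Nat.exists_eq_add_of_le' hj
  rw [Nat.add_sub_cancel, pow_succ]
  ring

end relations

end MultipleL

/-! ### Specialization to levels 1 and 3 -/

theorem mainTheorem11 (k : ℕ) (hk : 3 ≤ k) :
    -- all series that occur converge
    ((ConvergesL 1 (level1 [k]) ∧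
        ∀ j ∈ Finset.Ico 2 k, ConvergesL 1 (level1 [j, k - j])) ∧
      (∀ a : ZMod 3, ConvergesL 3 [(k, a)]) ∧
      (∀ j ∈ Finset.Ico 1 k, ∀ a b : ZMod 3, (2 ≤ j ∨ a ≠ 0) →
        ConvergesL 3 [(j, a), (k - j, b)])) ∧
    -- the weighted sum formulas
    (∑ j ∈ Finset.Ico 2 k, (2 : ℂ) ^ j * MultipleL.zeta [j, k - j]
      = ((k : ℂ) + 1) * MultipleL.zeta [k]) ∧
    (∑ j ∈ Finset.Ico 2 k, (2 : ℂ) ^ j * zeta3 [bar j, plain (k - j)]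
      = 2 * zeta3 [bar 1, tilde (k - 1)] - 2 * zeta3 [bar 1, plain (k - 1)]
        + 2 * zeta3 [tilde (k - 1), bar 1] - 2 * zeta3 [tilde (k - 1), tilde 1]
        + ((k : ℂ) - 1) * zeta3 [tilde k] + 2 * MultipleL.zeta [k]) ∧
    (∑ j ∈ Finset.Ico 2 k, (2 : ℂ) ^ j * zeta3 [tilde j, plain (k - j)]
      = 2 * zeta3 [tilde 1, bar (k - 1)] - 2 * zeta3 [tilde 1, plain (k - 1)]
        + 2 * zeta3 [bar (k - 1), tilde 1] - 2 * zeta3 [bar (k - 1), bar 1]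
        + ((k : ℂ) - 1) * zeta3 [bar k] + 2 * MultipleL.zeta [k]) ∧
    (∑ j ∈ Finset.Ico 2 k, (2 : ℂ) ^ (j - 1) * zeta3 [plain j, bar (k - j)]
        + ∑ j ∈ Finset.Ico 2 k, (2 : ℂ) ^ (j - 1) * zeta3 [bar j, tilde (k - j)]
      = zeta3 [bar 1, bar (k - 1)] - zeta3 [bar 1, tilde (k - 1)]
        + zeta3 [bar (k - 1), bar 1] - zeta3 [bar (k - 1), tilde 1]
        + (k : ℂ) * zeta3 [bar k] + zeta3 [tilde k]) ∧
    (∑ j ∈ Finset.Ico 2 k, (2 : ℂ) ^ (j - 1) * zeta3 [plain j, tilde (k - j)]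
        + ∑ j ∈ Finset.Ico 2 k, (2 : ℂ) ^ (j - 1) * zeta3 [tilde j, bar (k - j)]
      = zeta3 [tilde 1, tilde (k - 1)] - zeta3 [tilde 1, bar (k - 1)]
        + zeta3 [tilde (k - 1), tilde 1] - zeta3 [tilde (k - 1), bar 1]
        + (k : ℂ) * zeta3 [tilde k] + zeta3 [bar k]) ∧
    (∑ j ∈ Finset.Ico 2 k, (2 : ℂ) ^ (j - 1) * zeta3 [bar j, bar (k - j)]
        + ∑ j ∈ Finset.Ico 2 k, (2 : ℂ) ^ (j - 1) * zeta3 [tilde j, tilde (k - j)]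
      = zeta3 [bar 1, plain (k - 1)] - zeta3 [bar 1, bar (k - 1)]
        + zeta3 [tilde 1, plain (k - 1)] - zeta3 [tilde 1, tilde (k - 1)]
        + ((k : ℂ) - 1) * MultipleL.zeta [k] + zeta3 [bar k] + zeta3 [tilde k]) := by
  have hsum (f : ℕ → ℂ) : ∑ j ∈ Finset.Ico 2 k, (2 : ℂ) ^ j * f j =
      ∑ j ∈ Finset.Ico 2 k, (2 : ℂ) ^ (j - 1) * (f j + f j) :=
    Finset.sum_congr rfl fun j hj => two_pow_mul_eq (by have := Finset.mem_Ico.1 hj; omega) _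
  have hone : (1 : ZMod 3) ≠ 0 := by decide
  have htwo : (2 : ZMod 3) ≠ 0 := by decide
  have e11 : (1 : ZMod 3) + 1 = 2 := by decide
  have e12 : (1 : ZMod 3) + 2 = 0 := by decide
  have e21 : (2 : ZMod 3) + 1 = 0 := by decide
  have e22 : (2 : ZMod 3) + 2 = 1 := by decide
  have s12 : (1 : ZMod 3) - 2 = 2 := by decide
  have s21 : (2 : ZMod 3) - 1 = 1 := by decide
  have n1 : -(1 : ZMod 3) = 2 := by decide
  have n2 : -(2 : ZMod 3) = 1 := by decide
  refine ⟨⟨⟨convergesL_single 0 (by omega), fun j hj => ?_⟩,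
    fun a => convergesL_single a (by omega), fun j hj a b hab => ?_⟩, ?_, ?_, ?_, ?_, ?_, ?_⟩
  · rw [Finset.mem_Ico] at hj
    exact convergesL_double 0 0 hj.1 (by omega)
  · rw [Finset.mem_Ico] at hj
    rcases Nat.lt_or_ge j 2 with h | h
    · obtain rfl : j = 1 := by omega
      exact convergesL_double_one (hab.resolve_left (by omega)) b (by omega)
    · exact convergesL_double a b h (by omega)
  · rw [hsum]
    exact weighted_sum_zero_zero (N := 1) hk
  · have h := weighted_sum hone hone hk
    simp only [e11, e12, sub_self, n1] at h
    -- The value ζ(k) enters at level 3 as the trivial character 1 + (1 + 1) = 0.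
    simp only [hsum, zeta_single_eq (N := 3), zeta3, plain, bar, tilde]
    linear_combination h
  · have h := weighted_sum htwo htwo hk
    simp only [e22, e21, sub_self, n2] at h
    simp only [hsum, zeta_single_eq (N := 3), zeta3, plain, bar, tilde]
    linear_combination h
  · have h := weighted_sum_zero hone hk
    simp only [e11, n1] at h
    simp only [← Finset.sum_add_distrib, ← mul_add, zeta3, plain, bar, tilde]
    linear_combination h
  · have h := weighted_sum_zero htwo hk
    simp only [e22, n2] at h
    simp only [← Finset.sum_add_distrib, ← mul_add, zeta3, plain, bar, tilde]
    linear_combination h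
  · have h := weighted_sum hone htwo hk
    simp only [e12, e21, add_zero, s12, s21, n1, n2] at h
    simp only [← Finset.sum_add_distrib, ← mul_add, zeta_single_eq (N := 3), zeta3, plain, bar,
      tilde]
    linear_combination h
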